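/- Let $K$ be a field of characteristic $0$, complete with respect to a nontrivial non-archimedean absolute value. Let $0\neq\lambda\in K$ and let $$F_0(x,y)=(f(x),\lambda y(1+g(x))),$$ where $f$ and $g$ are $K$-analytic in a neighbourhood of $0$ in $K$, with $f(x)=x+\rho x^m+O(x^{m+1})$ for some integer $m\ge 2$ and some $0\ne\rho\in K$, and $g(0)=0$. Then there are a polynomial $r\in K[x]$ with $r(0)=0$ and $\deg r<m$, an element $\mu\in K$, and functions $h,k$ analytic at $0$ with $h(0)=0$, $h'(0)=1$, $k(0)=1$, such that the map $H(x,y)=(h(x),y\,k(x))$ is analytic at $0$ with an analytic local inverse at $0$, and, as germs at $0$, $$H\circ F_0\circ H^{-1}(x,y)=\bigl(x+\rho x^m+\mu x^{2m-1},\ \lambda y(1+r(x))\bigr).$$ -/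

import Mathlib

open Filter Topology Asymptotics

/-- `G` is a local inverse of `H` at the fixed point `0`, and it is analytic there
(equality is equality of germs at `0`). -/
structure IsAnalyticLocalInverse {K : Type*} [NontriviallyNormedField K]
    (H G : K × K → K × K) : Prop where
  analyticAt : AnalyticAt K G 0
  map_zero : G 0 = 0
  right_inv : ∀ᶠ p in 𝓝 (0 : K × K), H (G p) = p
  left_inv : ∀ᶠ p in 𝓝 (0 : K × K), G (H p) = p

/-- The locally invertible analytic germ `H` at `0` conjugates the germ of `F` to the germ of `F'`,
that is, `H ∘ F ∘ H⁻¹ = F'` near `0`. -/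
def AnalyticallyConjugates {K : Type*} [NontriviallyNormedField K]
    (H F F' : K × K → K × K) : Prop :=
  AnalyticAt K H 0 ∧ H 0 = 0 ∧
    ∃ G : K × K → K × K, IsAnalyticLocalInverse H G ∧
      ∀ᶠ p in 𝓝 (0 : K × K), H (F (G p)) = F' p

/-! The first coordinate calls for `h` with h∘f = h + ρh^m + μh^(2m-1). Adding c·x^n to a formal
solution changes the defect by c(n-m)ρ·x^(n+m-1) modulo higher order, so coefficients can be solved
for successively except at the resonance n = m, where the obstruction of order 2m-1 is absorbed by
μ. The second coordinate calls for k∘f = (1+q)k with 1+q = (1+r∘h)/(1+g). Here the divisors are nρ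
and never vanish. The only obstruction is that q = O(x^m), which holds when r is the Taylor
polynomial of g∘h⁻¹ of degree below m.

The formal solutions converge because the field is non-archimedean: sums cost only a maximum, and
the accumulated divisors are factorials, whose norms are at least c^n in characteristic 0
(`exists_pow_le_norm_factorial`). Thus coefficients grow at most geometrically
(`PowerSeries.norm_coeff_le_of_conjDefect`, `PowerSeries.norm_coeff_le_of_linear_recursion`). The
formal identities become identities of germs since an analytic germ that is O(x^n) for all n
vanishes. -/

/-! ### Asymptotic expansions of one-variable germs -/

section Taylor

variable {K : Type*} [NontriviallyNormedField K]

/-- `p` is the asymptotic expansion of `u` at `0`, to all orders. -/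
def HasTaylor (u : K → K) (p : PowerSeries K) : Prop :=
  ∀ N : ℕ, (fun x => u x - (PowerSeries.trunc N p).eval x) =O[𝓝 0] (fun x : K => x ^ N)

theorem Polynomial.isBigO_eval_one (P : Polynomial K) :
    (fun x => P.eval x) =O[𝓝 0] (fun _ : K => (1 : K)) :=
  (P.continuous.tendsto 0).isBigO_one K

theorem Polynomial.isBigO_eval_of_X_pow_dvd {P : Polynomial K} {N : ℕ}
    (h : Polynomial.X ^ N ∣ P) : (fun x => P.eval x) =O[𝓝 0] (fun x : K => x ^ N) := by
  obtain ⟨Q, rfl⟩ := h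
  simpa using (isBigO_refl (fun x : K => x ^ N) (𝓝 0)).mul Q.isBigO_eval_one

namespace HasTaylor

theorem isBigO_one {u : K → K} {p : PowerSeries K} (h : HasTaylor u p) :
    u =O[𝓝 0] (fun _ : K => (1 : K)) := by
  simpa only [PowerSeries.trunc_zero', Polynomial.eval_zero, sub_zero, pow_zero] using h 0

theorem polynomial (P : Polynomial K) : HasTaylor (fun x => P.eval x) (P : PowerSeries K) := by
  intro N
  have : Polynomial.X ^ N ∣ P - PowerSeries.trunc N (P : PowerSeries K) := by
    rw [Polynomial.X_pow_dvd_iff]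
    intro d hd
    simp [PowerSeries.coeff_trunc, hd]
  simpa using Polynomial.isBigO_eval_of_X_pow_dvd this

theorem add {u v : K → K} {p q : PowerSeries K} (hu : HasTaylor u p) (hv : HasTaylor v q) :
    HasTaylor (fun x => u x + v x) (p + q) := by
  intro N
  refine ((hu N).add (hv N)).congr_left fun x => ?_
  simp only [map_add, Polynomial.eval_add]
  ring

theorem mul {u v : K → K} {p q : PowerSeries K} (hu : HasTaylor u p) (hv : HasTaylor v q) :
    HasTaylor (fun x => u x * v x) (p * q) := by
  intro N
  set P := PowerSeries.trunc N p with hP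
  set Q := PowerSeries.trunc N q with hQ
  have hd : Polynomial.X ^ N ∣ P * Q - PowerSeries.trunc N (p * q) := by
    rw [Polynomial.X_pow_dvd_iff]
    intro d hd
    rw [Polynomial.coeff_sub, PowerSeries.coeff_trunc, if_pos hd,
      PowerSeries.coeff_mul_eq_coeff_trunc_mul_trunc p q hd, ← Polynomial.coeff_coe,
      Polynomial.coe_mul, sub_self]
  have h1 := (hu N).mul hv.isBigO_one
  have h2 := P.isBigO_eval_one.mul (hv N)
  simp only [mul_one, one_mul] at h1 h2
  refine ((h1.add h2).add (Polynomial.isBigO_eval_of_X_pow_dvd hd)).congr_left fun x => ?_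
  simp only [Polynomial.eval_sub, Polynomial.eval_mul]
  ring

theorem const (c : K) : HasTaylor (fun _ => c) (PowerSeries.C c) := by
  simpa using polynomial (Polynomial.C c)

theorem neg {u : K → K} {p : PowerSeries K} (hu : HasTaylor u p) :
    HasTaylor (fun x => - u x) (-p) := by
  simpa using (const (-1 : K)).mul hu

theorem sub {u v : K → K} {p q : PowerSeries K} (hu : HasTaylor u p) (hv : HasTaylor v q) :
    HasTaylor (fun x => u x - v x) (p - q) := by
  simpa [sub_eq_add_neg] using hu.add hv.neg

theorem pow {u : K → K} {p : PowerSeries K} (hu : HasTaylor u p) (n : ℕ) :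
    HasTaylor (fun x => u x ^ n) (p ^ n) := by
  induction n with
  | zero => simpa using const (1 : K)
  | succ n ih => simpa only [pow_succ] using ih.mul hu

theorem aeval {u : K → K} {p : PowerSeries K} (hu : HasTaylor u p) (P : Polynomial K) :
    HasTaylor (fun x => P.eval (u x)) (Polynomial.aeval p P) := by
  induction P using Polynomial.induction_on' with
  | add P Q hP hQ => simpa using hP.add hQ
  | monomial n a =>
    simpa [Polynomial.aeval_monomial, PowerSeries.algebraMap_apply] using (const a).mul (hu.pow n)

theorem isBigO_of_X_pow_dvd {u : K → K} {p : PowerSeries K} (hu : HasTaylor u p) {N : ℕ}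
    (h : PowerSeries.X ^ N ∣ p) : u =O[𝓝 0] (fun x : K => x ^ N) := by
  have h0 : PowerSeries.trunc N p = 0 := by
    ext d
    rw [PowerSeries.coeff_trunc]
    split_ifs with hd
    · simpa using PowerSeries.X_pow_dvd_iff.1 h d hd
    · simp
  simpa [h0] using hu N

/-- Once the lower coefficients vanish, a_d·x^d is O(x^(d+1)). Dividing by x^d and letting x tend to
0 through nonzero values kills a_d. -/
theorem X_pow_dvd_of_isBigO {u : K → K} {p : PowerSeries K} (hu : HasTaylor u p) {N : ℕ}
    (h : u =O[𝓝 0] (fun x : K => x ^ N)) : PowerSeries.X ^ N ∣ p := by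
  rw [PowerSeries.X_pow_dvd_iff]
  intro d
  induction d using Nat.strong_induction_on with
  | _ d ih =>
    intro hd
    have ht : PowerSeries.trunc (d + 1) p = Polynomial.monomial d (PowerSeries.coeff d p) := by
      ext i
      rw [PowerSeries.coeff_trunc, Polynomial.coeff_monomial]
      rcases lt_trichotomy i d with hi | rfl | hi
      · rw [if_pos (by omega), if_neg (by omega), ih i hi (by omega)]
      · simp
      · rw [if_neg (by omega), if_neg (by omega)]
    have hle : (fun x : K => x ^ N) =O[𝓝 0] (fun x : K => x ^ (d + 1)) := by
      have := Polynomial.isBigO_eval_of_X_pow_dvd (K := K) (P := Polynomial.X ^ N) (N := d + 1)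
        (pow_dvd_pow _ hd)
      simpa using this
    have h1 := (h.trans hle).sub (hu (d + 1))
    simp only [sub_sub_cancel, ht, Polynomial.eval_monomial] at h1
    obtain ⟨c, hc⟩ := h1.bound
    by_contra hne
    have hlim : Tendsto (fun x : K => c * ‖x‖) (𝓝[≠] 0) (𝓝 0) := by
      have : Tendsto (fun x : K => c * ‖x‖) (𝓝 0) (𝓝 (c * ‖(0 : K)‖)) :=
        (continuous_const.mul continuous_norm).tendsto 0
      simpa using this.mono_left nhdsWithin_le_nhds
    have hle' : ∀ᶠ x : K in 𝓝[≠] 0, ‖PowerSeries.coeff d p‖ ≤ c * ‖x‖ := by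
      filter_upwards [hc.filter_mono nhdsWithin_le_nhds, self_mem_nhdsWithin] with x hx hx0
      have hx0 : 0 < ‖x‖ ^ d := pow_pos (norm_pos_iff.2 hx0) d
      rw [norm_mul, norm_pow, norm_pow, pow_succ] at hx
      refine le_of_mul_le_mul_right ?_ hx0
      linarith
    exact hne (norm_le_zero_iff.1 (ge_of_tendsto hlim hle'))

theorem of_hasFPowerSeriesAt {u : K → K} {P : FormalMultilinearSeries K K K}
    (h : HasFPowerSeriesAt u P 0) : HasTaylor u (PowerSeries.mk P.coeff) := by
  intro N
  refine ((h.isBigO_sub_partialSum_pow N).congr_left fun x => ?_).trans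
    (isBigO_of_le _ fun x => by simp)
  rw [zero_add, FormalMultilinearSeries.partialSum, ← Polynomial.eval₂_id,
    PowerSeries.eval₂_trunc_eq_sum_range]
  congr 1
  refine Finset.sum_congr rfl fun i _ => ?_
  rw [FormalMultilinearSeries.apply_eq_pow_smul_coeff]
  simp [mul_comm]

end HasTaylor

theorem AnalyticAt.exists_hasTaylor {u : K → K} (hu : AnalyticAt K u 0) :
    ∃ p : PowerSeries K, HasTaylor u p ∧
      ∃ R : ℝ, 1 ≤ R ∧ ∀ n, 1 ≤ n → ‖PowerSeries.coeff n p‖ ≤ R ^ n := by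
  obtain ⟨P, hP⟩ := hu
  obtain ⟨C, r, hC, hr, h⟩ := P.le_mul_pow_of_radius_pos hP.radius_pos
  -- The constant `C` is absorbed into the base of the power, which is possible only for n ≥ 1.
  refine ⟨_, HasTaylor.of_hasFPowerSeriesAt hP, max C 1 * max r 1, ?_, fun n hn => ?_⟩
  · exact one_le_mul_of_one_le_of_one_le (le_max_right _ _) (le_max_right _ _)
  · rw [PowerSeries.coeff_mk, mul_pow]
    refine P.norm_apply_eq_norm_coef.symm.le.trans ((h n).trans ?_)
    have h2 : C ≤ max C 1 ^ n :=
      (le_max_left C 1).trans (le_self_pow₀ (le_max_right _ _) (by omega))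
    have h3 : r ^ n ≤ max r 1 ^ n := pow_le_pow_left₀ hr.le (le_max_left _ _) n
    exact mul_le_mul h2 h3 (by positivity) (by positivity)

theorem PowerSeries.exists_analyticAt_hasTaylor [CompleteSpace K] (p : PowerSeries K) {R : ℝ}
    (hR : 0 < R) (h : ∀ n, ‖PowerSeries.coeff n p‖ ≤ R ^ n) :
    ∃ u : K → K, AnalyticAt K u 0 ∧ HasTaylor u p := by
  set P : FormalMultilinearSeries K K K :=
    FormalMultilinearSeries.ofScalars K (fun n => PowerSeries.coeff n p) with hP
  have hrad : 0 < P.radius := by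
    refine lt_of_lt_of_le ?_ (P.le_radius_of_bound 1 (r := R.toNNReal⁻¹) fun n => ?_)
    · simpa using hR
    · rw [hP, FormalMultilinearSeries.ofScalars_norm, NNReal.coe_inv, Real.coe_toNNReal _ hR.le]
      calc ‖PowerSeries.coeff n p‖ * (R⁻¹) ^ n ≤ R ^ n * (R⁻¹) ^ n := by
            gcongr; exact h n
        _ = 1 := by rw [← mul_pow, mul_inv_cancel₀ hR.ne', one_pow]
  have hs := (P.hasFPowerSeriesOnBall hrad).hasFPowerSeriesAt
  refine ⟨P.sum, hs.analyticAt, ?_⟩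
  convert HasTaylor.of_hasFPowerSeriesAt hs
  ext n
  simp [hP]

theorem AnalyticAt.eventually_eq_zero_of_isBigO_pow {u : K → K} (hu : AnalyticAt K u 0)
    (h : ∀ n : ℕ, u =O[𝓝 0] (fun x : K => x ^ n)) : ∀ᶠ x in 𝓝 (0 : K), u x = 0 := by
  obtain ⟨P, hP⟩ := hu
  have hT := HasTaylor.of_hasFPowerSeriesAt hP
  have hP0 : P = 0 := by
    ext1 n
    have hd := PowerSeries.X_pow_dvd_iff.1 (hT.X_pow_dvd_of_isBigO (h (n + 1))) n n.lt_succ_self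
    exact FormalMultilinearSeries.coeff_eq_zero.1 (by simpa using hd)
  exact hP.locally_zero_iff.2 hP0

end Taylor

/-! ### Order-by-order solution of formal equations -/

section Recursion

variable {K : Type*} [Field K]

open Polynomial in
-- The common scheme of both formal problems: a term c·x^n first affects the defect `E` at order
-- n+d, with factor δ n ≠ 0, so c can be chosen to cancel that order. Evaluating `E` only on
-- truncations avoids composing power series. The recursion is kept in the conclusion for the norm
-- estimates.
theorem exists_powerSeries_of_triangular (E : K[X] → PowerSeries K) (d n₀ : ℕ) (δ : ℕ → K)
    (t₀ : K[X]) (ht₀ : t₀.degree < n₀) (hE₀ : PowerSeries.X ^ (n₀ + d) ∣ E t₀)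
    (hδ : ∀ n, n₀ ≤ n → δ n ≠ 0)
    (hE : ∀ n, n₀ ≤ n → ∀ t : K[X], X ^ n₀ ∣ t - t₀ → t.degree < n → ∀ c,
      PowerSeries.X ^ (n + d + 1) ∣
        E (t + monomial n c) - E t - PowerSeries.C (c * δ n) * PowerSeries.X ^ (n + d)) :
    ∃ a : PowerSeries K, PowerSeries.trunc n₀ a = t₀ ∧ ∀ n, n₀ ≤ n →
      PowerSeries.X ^ (n + d) ∣ E (PowerSeries.trunc n a) ∧
      PowerSeries.coeff n a * δ n = - PowerSeries.coeff (n + d) (E (PowerSeries.trunc n a)) := by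
  let c : ℕ → K[X] → K := fun n t => - PowerSeries.coeff (n + d) (E t) / δ n
  let s : ℕ → K[X] := fun i => Nat.rec t₀ (fun i t => t + monomial (n₀ + i) (c (n₀ + i) t)) i
  have hs : ∀ i, s (i + 1) = s i + monomial (n₀ + i) (c (n₀ + i) (s i)) := fun i => rfl
  let a : PowerSeries K := PowerSeries.mk fun n =>
    if n < n₀ then t₀.coeff n else c n (s (n - n₀))
  have htr₀ : PowerSeries.trunc n₀ a = t₀ := by
    ext i
    rw [PowerSeries.coeff_trunc]
    split_ifs with hi
    · simp [a, hi]
    · exact (coeff_eq_zero_of_degree_lt (ht₀.trans_le (by exact_mod_cast not_lt.1 hi))).symm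
  have htr : ∀ i, PowerSeries.trunc (n₀ + i) a = s i := by
    intro i
    induction i with
    | zero => exact htr₀
    | succ i ih =>
      rw [← add_assoc, PowerSeries.trunc_succ, ih, hs]
      simp [a]
  have hmod : ∀ n, n₀ ≤ n → X ^ n₀ ∣ PowerSeries.trunc n a - t₀ := by
    intro n hn
    rw [← htr₀, X_pow_dvd_iff]
    intro i hi
    rw [coeff_sub, PowerSeries.coeff_trunc, PowerSeries.coeff_trunc, if_pos hi,
      if_pos (by omega), sub_self]
  have hca : ∀ n, n₀ ≤ n → PowerSeries.coeff n a = c n (PowerSeries.trunc n a) := by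
    intro n hn
    obtain ⟨i, rfl⟩ := Nat.exists_eq_add_of_le hn
    rw [htr]
    simp [a]
  have hrel : ∀ n, n₀ ≤ n → PowerSeries.coeff n a * δ n =
      - PowerSeries.coeff (n + d) (E (PowerSeries.trunc n a)) := by
    intro n hn
    rw [hca n hn, div_mul_cancel₀ _ (hδ n hn)]
  refine ⟨a, htr₀, fun n hn => ⟨?_, hrel n hn⟩⟩
  induction n, hn using Nat.le_induction with
  | base => rwa [htr₀]
  | succ n hn ih =>
    have h := hE n hn _ (hmod n hn) (PowerSeries.degree_trunc_lt a n) (PowerSeries.coeff n a)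
    rw [← PowerSeries.trunc_succ, hrel n hn] at h
    rw [PowerSeries.X_pow_dvd_iff] at h ih ⊢
    intro i hi
    have h1 := h i (by omega)
    rw [map_sub, map_sub, PowerSeries.coeff_C_mul, PowerSeries.coeff_X_pow] at h1
    rcases eq_or_ne i (n + d) with rfl | hne
    · simpa using h1
    · have h2 := ih i (by omega)
      simpa [hne, h2] using h1

/-- First-order expansion of a power of a series tangent to the identity. -/
theorem X_pow_dvd_pow_sub {f : PowerSeries K} {ρ : K} {m : ℕ} (hm : 2 ≤ m)
    (hf : PowerSeries.X ^ (m + 1) ∣ f - PowerSeries.X - PowerSeries.C ρ * PowerSeries.X ^ m)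
    (n : ℕ) (hn : 1 ≤ n) :
    PowerSeries.X ^ (n + (m - 1) + 1) ∣
      f ^ n - PowerSeries.X ^ n - PowerSeries.C (n * ρ) * PowerSeries.X ^ (n + (m - 1)) := by
  obtain ⟨s, hs⟩ := hf
  obtain ⟨e, rfl⟩ := Nat.exists_eq_add_of_le' hm
  obtain ⟨j, rfl⟩ := Nat.exists_eq_add_of_le' hn
  set x : PowerSeries K := PowerSeries.X
  set r : PowerSeries K := PowerSeries.C ρ
  have hf' : f = x * (1 + x ^ (e + 1) * (r + x * s)) := by
    linear_combination hs
  -- Second-order binomial expansion after factoring out X; `k` multiplies the quadratic remainder.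
  obtain ⟨k, hk⟩ :=
    Polynomial.powAddExpansion (1 : PowerSeries K) (x ^ (e + 1) * (r + x * s)) (j + 1)
  refine ⟨(j + 1) * s + k * x ^ e * (r + x * s) ^ 2, ?_⟩
  have hC : PowerSeries.C (((j + 1 : ℕ) : K) * ρ) = ((j : PowerSeries K) + 1) * r := by
    simp [r]
  rw [hC, hf', mul_pow, hk]
  push_cast
  ring

/-- First-order expansion of a power under perturbation of a coefficient. -/
theorem X_pow_dvd_add_pow_sub {t : PowerSeries K} (ht : PowerSeries.X ^ 2 ∣ t - PowerSeries.X)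
    (n : ℕ) (hn : 2 ≤ n) (c : K) (j : ℕ) (hj : 1 ≤ j) :
    PowerSeries.X ^ (n + j) ∣
      (t + PowerSeries.C c * PowerSeries.X ^ n) ^ j - t ^ j -
        PowerSeries.C (j * c) * PowerSeries.X ^ (n + (j - 1)) := by
  obtain ⟨s, hs⟩ := ht
  obtain ⟨e, rfl⟩ := Nat.exists_eq_add_of_le' hn
  obtain ⟨i, rfl⟩ := Nat.exists_eq_add_of_le' hj
  set x : PowerSeries K := PowerSeries.X
  set r : PowerSeries K := PowerSeries.C c
  have ht' : t = x * (1 + x * s) := by linear_combination hs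
  obtain ⟨k, hk⟩ := Polynomial.powAddExpansion (1 + x * s) (r * x ^ (e + 1)) (i + 1)
  obtain ⟨v, hv⟩ : x ∣ (1 + x * s) ^ i - 1 := by
    refine dvd_trans ⟨s, ?_⟩ (sub_one_dvd_pow_sub_one (1 + x * s) i)
    ring
  refine ⟨(i + 1) * r * v + k * r ^ 2 * x ^ e, ?_⟩
  have hC : PowerSeries.C (((i + 1 : ℕ) : K) * c) = ((i : PowerSeries K) + 1) * r := by
    simp [r]
  have h1 : t + r * x ^ (e + 2) = x * ((1 + x * s) + r * x ^ (e + 1)) := by rw [ht']; ring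
  rw [hC, h1, ht', mul_pow, hk]
  push_cast
  have hv' : (1 + x * s) ^ i = 1 + x * v := by linear_combination hv
  rw [hv', mul_pow x]
  ring

end Recursion

/-! ### Ultrametric estimates for factorials and coefficients -/

section NormBounds

variable {K : Type*} [NormedField K] [IsUltrametricDist K]

/-- In a Bézout relation pa + qb = 1 the two terms cannot both have norm below 1. -/
theorem norm_natCast_eq_one_of_coprime {p q : ℕ} (hp : ‖(p : K)‖ < 1) (h : Nat.Coprime p q) :
    ‖(q : K)‖ = 1 := by
  refine le_antisymm (IsUltrametricDist.norm_natCast_le_one K q) ?_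
  have hb : ((p : ℤ) * p.gcdA q + (q : ℤ) * p.gcdB q) = 1 := by
    rw [← Nat.gcd_eq_gcd_ab, h.gcd_eq_one, Nat.cast_one]
  have hb' : (p : K) * (p.gcdA q : ℤ) + (q : K) * (p.gcdB q : ℤ) = 1 := by
    exact_mod_cast congrArg (Int.cast : ℤ → K) hb
  by_contra! hq
  have hlt : ‖(p : K) * (p.gcdA q : ℤ) + (q : K) * (p.gcdB q : ℤ)‖ < 1 := by
    refine (IsUltrametricDist.norm_add_le_max _ _).trans_lt (max_lt ?_ ?_)
    · rw [norm_mul]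
      exact (mul_le_of_le_one_right (norm_nonneg _)
        (IsUltrametricDist.norm_intCast_le_one K _)).trans_lt hp
    · rw [norm_mul]
      exact (mul_le_of_le_one_right (norm_nonneg _)
        (IsUltrametricDist.norm_intCast_le_one K _)).trans_lt hq
  rw [hb', norm_one] at hlt
  exact lt_irrefl _ hlt

variable (K) in
/-- In a non-archimedean field of characteristic zero, factorials decay at most exponentially. -/
theorem exists_pow_le_norm_factorial [CharZero K] :
    ∃ c : ℝ, 0 < c ∧ c ≤ 1 ∧ ∀ n : ℕ, c ^ n ≤ ‖(n.factorial : K)‖ := by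
  by_cases h : ∃ p : ℕ, p.Prime ∧ ‖(p : K)‖ < 1
  · obtain ⟨p, hp, hlt⟩ := h
    have : Fact p.Prime := ⟨hp⟩
    have hpos : 0 < ‖(p : K)‖ := norm_pos_iff.2 (Nat.cast_ne_zero.2 hp.ne_zero)
    refine ⟨‖(p : K)‖, hpos, hlt.le, fun n => ?_⟩
    obtain ⟨v, q, hq, hn⟩ := Nat.exists_eq_pow_mul_and_not_dvd n.factorial_ne_zero p hp.ne_one
    -- Legendre's formula gives (p-1)·v_p(n!) = n minus the base-p digit sum, hence v_p(n!) ≤ n.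
    have hv : v ≤ n := by
      have h1 : v ≤ padicValNat p n.factorial :=
        (padicValNat_dvd_iff_le n.factorial_ne_zero).1 ⟨q, hn⟩
      have h2 := sub_one_mul_padicValNat_factorial (p := p) n
      have h3 : padicValNat p n.factorial ≤ (p - 1) * padicValNat p n.factorial :=
        Nat.le_mul_of_pos_left _ (Nat.sub_pos_of_lt hp.one_lt)
      omega
    rw [hn, Nat.cast_mul, Nat.cast_pow, norm_mul, norm_pow,
      norm_natCast_eq_one_of_coprime hlt (hp.coprime_iff_not_dvd.2 hq), mul_one]
    exact pow_le_pow_of_le_one hpos.le hlt.le hv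
  · push Not at h
    refine ⟨1, one_pos, le_rfl, fun n => ?_⟩
    rw [one_pow]
    induction n with
    | zero => simp
    | succ n ih =>
      have h1 : ∀ k : ℕ, k ≠ 0 → 1 ≤ ‖(k : K)‖ := by
        intro k
        induction k using Nat.recOnMul with
        | zero => simp
        | one => simp
        | prime p hp => exact fun _ => h p hp
        | mul a b ha hb =>
          intro hab
          rw [Nat.cast_mul, norm_mul]
          exact one_le_mul_of_one_le_of_one_le (ha (left_ne_zero_of_mul hab))
            (hb (right_ne_zero_of_mul hab))
      rw [Nat.factorial_succ, Nat.cast_mul, norm_mul]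
      exact one_le_mul_of_one_le_of_one_le (h1 _ n.succ_ne_zero) ih

theorem norm_natCast_le_of_dvd {a b : ℕ} (h : a ∣ b) : ‖(b : K)‖ ≤ ‖(a : K)‖ := by
  obtain ⟨c, rfl⟩ := h
  rw [Nat.cast_mul, norm_mul]
  exact mul_le_of_le_one_right (norm_nonneg _) (IsUltrametricDist.norm_natCast_le_one K c)

theorem norm_sub_le_max_of_isUltrametricDist (x y : K) : ‖x - y‖ ≤ max ‖x‖ ‖y‖ := by
  simpa [sub_eq_add_neg] using IsUltrametricDist.norm_add_le_max x (-y)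

namespace PowerSeries

/-- By the ultrametric inequality a supermultiplicative weight passes to products without any
constant, hence to all powers with the same bound. The cutoff `M` matters: the capped weight used
for the conjugacy is supermultiplicative only in a bounded range. -/
theorem norm_coeff_mul_le {v : ℕ → ℝ} {M : ℕ}
    (hv : ∀ a b, a + b ≤ M → v a * v b ≤ v (a + b)) {p q : PowerSeries K}
    (hp : ∀ i ≤ M, ‖coeff i p‖ ≤ v i) (hq : ∀ i ≤ M, ‖coeff i q‖ ≤ v i) :
    ∀ i ≤ M, ‖coeff i (p * q)‖ ≤ v i := by
  intro i hi
  rw [coeff_mul]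
  refine IsUltrametricDist.norm_sum_le_of_forall_le_of_nonneg
    ((norm_nonneg _).trans (hp i hi)) fun x hx => ?_
  rw [Finset.HasAntidiagonal.mem_antidiagonal] at hx
  rw [norm_mul]
  refine (mul_le_mul (hp _ (by omega)) (hq _ (by omega)) (norm_nonneg _)
    ((norm_nonneg _).trans (hp _ (by omega)))).trans ?_
  rw [← hx]
  exact hv _ _ (by omega)

theorem norm_coeff_pow_le {v : ℕ → ℝ} {M : ℕ} (hv0 : 1 ≤ v 0)
    (hv : ∀ a b, a + b ≤ M → v a * v b ≤ v (a + b)) {p : PowerSeries K}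
    (hp : ∀ i ≤ M, ‖coeff i p‖ ≤ v i) (j : ℕ) :
    ∀ i ≤ M, ‖coeff i (p ^ j)‖ ≤ v i := by
  induction j with
  | zero =>
    intro i hi
    rw [pow_zero, coeff_one]
    split_ifs with h
    · simpa [h] using hv0
    · simpa using (norm_nonneg _).trans (hp i hi)
  | succ j ih =>
    rw [pow_succ]
    exact norm_coeff_mul_le hv ih hp

theorem norm_coeff_X_mul_pow_le {φ : PowerSeries K} {R : ℝ} (h : ∀ i, ‖coeff i φ‖ ≤ R ^ i)
    (j N : ℕ) (hj : j ≤ N) : ‖coeff N ((X * φ) ^ j)‖ ≤ R ^ (N - j) := by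
  rw [mul_pow, coeff_X_pow_mul', if_pos hj]
  exact norm_coeff_pow_le (v := fun i => R ^ i) (M := N - j) (by simp)
    (fun a b _ => (pow_add R a b).ge) (fun i _ => h i) j _ le_rfl

theorem norm_coeff_aeval_le {φ : PowerSeries K} {R C : ℝ} (h : ∀ i, ‖coeff i φ‖ ≤ R ^ i)
    (hC : 0 ≤ C) {t : Polynomial K} {n d : ℕ} (ht : t.degree < n)
    (hb : ∀ j < n, ‖t.coeff j‖ * R ^ (n + d - j) ≤ C) :
    ‖coeff (n + d) (Polynomial.aeval (X * φ) t)‖ ≤ C := by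
  have hs : Polynomial.aeval (X * φ) t =
      ∑ j ∈ Finset.range n, t.coeff j • (X * φ) ^ j := by
    rcases eq_or_ne t 0 with rfl | h0
    · simp
    · exact Polynomial.aeval_eq_sum_range' ((Polynomial.natDegree_lt_iff_degree_lt h0).2 ht) _
  rw [hs, map_sum]
  refine IsUltrametricDist.norm_sum_le_of_forall_le_of_nonneg hC fun j hj => ?_
  have hj := Finset.mem_range.1 hj
  rw [coeff_smul, smul_eq_mul, norm_mul]
  exact (mul_le_mul_of_nonneg_left (norm_coeff_X_mul_pow_le h j _ (by omega))
    (norm_nonneg _)).trans (hb j hj)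

end PowerSeries

/-- Since j < n, at least one factor `S` is to spare, and it pays for the shift `R ^ d`. -/
theorem mul_pow_mul_pow_le {R S ρ : ℝ} (hR : 1 ≤ R) (hS : 1 ≤ S) (hρ : 0 ≤ ρ) {d : ℕ}
    (hd : R ^ d ≤ ρ * S) {j n : ℕ} (hj : j < n) :
    (R * S) ^ j * R ^ (n + d - j) ≤ ρ * (R * S) ^ n := by
  obtain ⟨e, rfl⟩ := Nat.exists_eq_add_of_lt hj
  have h1 : j + e + 1 + d - j = e + 1 + d := by omega
  have h2 : S ≤ S ^ (e + 1) := le_self_pow₀ hS (by omega)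
  calc (R * S) ^ j * R ^ (j + e + 1 + d - j)
      = (R * S) ^ j * R ^ (e + 1) * R ^ d := by rw [h1, pow_add]; ring
    _ ≤ (R * S) ^ j * R ^ (e + 1) * (ρ * S ^ (e + 1)) := by
        gcongr
        exact hd.trans (by gcongr)
    _ = ρ * (R * S) ^ (j + e + 1) := by rw [add_assoc, pow_add _ j, mul_pow R S (e + 1)]; ring

end NormBounds

/-! ### Geometric growth of the formal solutions -/

section ConjugacyBounds

variable {K : Type*}

/-- The formal defect of `t` as a conjugacy from `f` to `x + ρ x ^ m + μ x ^ (2 m - 1)`. -/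
noncomputable def conjDefect [Field K] (f : PowerSeries K) (ρ μ : K) (m : ℕ) (t : Polynomial K) :
    PowerSeries K :=
  Polynomial.aeval f t - ((t : PowerSeries K) + PowerSeries.C ρ * (t : PowerSeries K) ^ m +
    PowerSeries.C μ * (t : PowerSeries K) ^ (2 * m - 1))

/-- Each step divides by nρ, so the divisors accumulate to n!. The induction bound is (RS)^n/‖n!‖,
and ‖n!‖ ≥ c^n makes it geometric. -/
theorem PowerSeries.norm_coeff_le_of_linear_recursion [NormedField K] [IsUltrametricDist K]
    [CharZero K] {φ q a : PowerSeries K} {R : ℝ} (hR : 1 ≤ R) (hφ : ∀ i, ‖coeff i φ‖ ≤ R ^ i)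
    (hq : ∀ i, ‖coeff i q‖ ≤ R ^ i) {ρ : K} (hρ : ρ ≠ 0) {d : ℕ} (ha0 : coeff 0 a = 1)
    (ha : ∀ n, 1 ≤ n → coeff n a * (n * ρ) = - coeff (n + d)
      (Polynomial.aeval (X * φ) (trunc n a) - (trunc n a : PowerSeries K) -
        q * (trunc n a : PowerSeries K))) :
    ∃ R' : ℝ, 0 < R' ∧ ∀ n, ‖coeff n a‖ ≤ R' ^ n := by
  have hρ' : 0 < ‖ρ‖ := norm_pos_iff.2 hρ
  obtain ⟨c, hc, hc1, hfac⟩ := exists_pow_le_norm_factorial K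
  set S : ℝ := max 1 (R ^ d / ‖ρ‖) with hS
  have hS1 : 1 ≤ S := le_max_left _ _
  have hRS : 0 < R * S := by positivity
  have hd : R ^ d ≤ ‖ρ‖ * S := by
    rw [← div_le_iff₀' hρ']; exact le_max_right _ _
  have hw : ∀ n : ℕ, 0 < ‖(n.factorial : K)‖ := fun n =>
    norm_pos_iff.2 (Nat.cast_ne_zero.2 n.factorial_ne_zero)
  have key : ∀ n, ‖coeff n a‖ ≤ (R * S) ^ n * ‖(n.factorial : K)‖⁻¹ := by
    intro n
    induction n using Nat.strong_induction_on with
    | _ n ih =>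
      rcases Nat.eq_zero_or_pos n with rfl | hn
      · simp [ha0]
      set W : ℝ := ‖((n - 1).factorial : K)‖⁻¹ with hW
      have hW0 : 0 < W := inv_pos.2 (hw _)
      set t := trunc n a
      have htj : ∀ j < n, ‖t.coeff j‖ ≤ (R * S) ^ j * W := by
        intro j hj
        rw [coeff_trunc, if_pos hj]
        refine (ih j hj).trans (mul_le_mul_of_nonneg_left (inv_anti₀ (hw _) ?_) (by positivity))
        exact norm_natCast_le_of_dvd (Nat.factorial_dvd_factorial (by omega))
      have hterm : ∀ j < n, ‖t.coeff j‖ * R ^ (n + d - j) ≤ W * (‖ρ‖ * (R * S) ^ n) := by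
        intro j hj
        calc ‖t.coeff j‖ * R ^ (n + d - j) ≤ (R * S) ^ j * W * R ^ (n + d - j) := by
              gcongr; exact htj j hj
          _ = W * ((R * S) ^ j * R ^ (n + d - j)) := by ring
          _ ≤ _ := by
              refine mul_le_mul_of_nonneg_left ?_ hW0.le
              exact mul_pow_mul_pow_le hR hS1 hρ'.le hd hj
      have hC : 0 ≤ W * (‖ρ‖ * (R * S) ^ n) := by positivity
      have h1 := norm_coeff_aeval_le hφ hC (degree_trunc_lt a n) hterm
      have h2 : coeff (n + d) (t : PowerSeries K) = 0 := by
        rw [Polynomial.coeff_coe, coeff_trunc, if_neg (by omega)]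
      have h3 : ‖coeff (n + d) (q * (t : PowerSeries K))‖ ≤ W * (‖ρ‖ * (R * S) ^ n) := by
        rw [mul_comm, coeff_mul]
        refine IsUltrametricDist.norm_sum_le_of_forall_le_of_nonneg hC fun x hx => ?_
        rw [Finset.HasAntidiagonal.mem_antidiagonal] at hx
        rw [norm_mul, Polynomial.coeff_coe]
        rcases lt_or_ge x.1 n with hx1 | hx1
        · refine le_trans ?_ (hterm x.1 hx1)
          gcongr
          rw [show n + d - x.1 = x.2 by omega]
          exact hq _
        · rw [coeff_trunc, if_neg (by omega), norm_zero, zero_mul]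
          exact hC
      have h4 : ‖coeff n a‖ * (‖(n : K)‖ * ‖ρ‖) ≤ W * (‖ρ‖ * (R * S) ^ n) := by
        rw [← norm_mul, ← norm_mul, ha n hn, norm_neg, map_sub, map_sub, h2, sub_zero]
        exact (norm_sub_le_max_of_isUltrametricDist _ _).trans (max_le h1 h3)
      have hn0 : 0 < ‖(n : K)‖ := norm_pos_iff.2 (Nat.cast_ne_zero.2 hn.ne')
      have hfacn : ‖(n.factorial : K)‖⁻¹ = ‖(n : K)‖⁻¹ * W := by
        rw [← Nat.mul_factorial_pred hn.ne', Nat.cast_mul, norm_mul, mul_inv]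
      rw [hfacn]
      refine le_of_mul_le_mul_right (h4.trans_eq ?_) (mul_pos hn0 hρ')
      field_simp
  refine ⟨R * S / c, by positivity, fun n => (key n).trans ?_⟩
  rw [div_pow, div_eq_mul_inv]
  gcongr
  exact hfac n

/-- The gain of one on the right gives room for the capped weight below, which must be
supermultiplicative one degree past its cap. -/
theorem Nat.factorial_sub_mul_factorial_sub_dvd {d a b : ℕ} (hd : 1 ≤ d) (ha : 1 ≤ a)
    (hb : 1 ≤ b) : (a - d).factorial * (b - d).factorial ∣ (a + b - 1 - d).factorial := by
  rcases le_or_gt a d with h | h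
  · rw [Nat.sub_eq_zero_of_le h, Nat.factorial_zero, one_mul]
    exact Nat.factorial_dvd_factorial (by omega)
  rcases le_or_gt b d with h' | h'
  · rw [Nat.sub_eq_zero_of_le h', Nat.factorial_zero, mul_one]
    exact Nat.factorial_dvd_factorial (by omega)
  exact (Nat.factorial_mul_factorial_dvd_factorial_add _ _).trans
    (Nat.factorial_dvd_factorial (by omega))

theorem PowerSeries.norm_coeff_le_of_conjDefect [NormedField K] [IsUltrametricDist K]
    [CharZero K] {φ a : PowerSeries K} {R : ℝ} (hR : 1 ≤ R) (hφ : ∀ i, ‖coeff i φ‖ ≤ R ^ i)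
    {ρ μ : K} (hρ : ρ ≠ 0) {m : ℕ} (hm : 2 ≤ m) (ha0 : coeff 0 a = 0) (ha1 : coeff 1 a = 1)
    (ha : ∀ n, m < n → coeff n a * (((n : K) - m) * ρ) = - coeff (n + (m - 1))
      (conjDefect (X * φ) ρ μ m (trunc n a))) :
    ∃ R' : ℝ, 0 < R' ∧ ∀ n, ‖coeff n a‖ ≤ R' ^ n := by
  have hρ' : 0 < ‖ρ‖ := norm_pos_iff.2 hρ
  obtain ⟨c, hc, hc1, hfac⟩ := exists_pow_le_norm_factorial K
  obtain ⟨d, rfl⟩ : ∃ d, m = d + 1 := ⟨m - 1, by omega⟩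
  simp only [Nat.add_sub_cancel] at ha
  have hd1 : 1 ≤ d := by omega
  -- The summands pay for composition with f, for the μ-term, and for the coefficients up to index m
  -- = d+1, which the recursion does not govern.
  set S : ℝ := 1 + R ^ d / ‖ρ‖ + ‖μ‖ / ‖ρ‖ + ∑ i ∈ Finset.range (d + 2), ‖coeff i a‖ with hSdef
  have hsum : 0 ≤ ∑ i ∈ Finset.range (d + 2), ‖coeff i a‖ :=
    Finset.sum_nonneg fun _ _ => norm_nonneg _
  have hq1 : 0 ≤ R ^ d / ‖ρ‖ := by positivity
  have hq2 : 0 ≤ ‖μ‖ / ‖ρ‖ := by positivity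
  have hS1 : 1 ≤ S := by linarith
  have hRS1 : 1 ≤ R * S := one_le_mul_of_one_le_of_one_le hR hS1
  have hRS : 0 < R * S := by positivity
  have hd : R ^ d ≤ ‖ρ‖ * S := by
    rw [← div_le_iff₀' hρ']; linarith
  have hμ : ‖μ‖ ≤ ‖ρ‖ * (R * S) := by
    rw [← div_le_iff₀' hρ']
    have : S ≤ R * S := le_mul_of_one_le_left (by positivity) hR
    linarith
  have hw : ∀ n : ℕ, 0 < ‖(n.factorial : K)‖ := fun n =>
    norm_pos_iff.2 (Nat.cast_ne_zero.2 n.factorial_ne_zero)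
  -- The divisor for the coefficient of index e+1 is e+1-m = e-d. Truncated subtraction gives weight
  -- 1 before the recursion starts.
  set w : ℕ → ℝ := fun e => ‖((e - d).factorial : K)‖⁻¹ with hwdef
  have hwpos : ∀ e, 0 < w e := fun e => inv_pos.2 (hw _)
  have hw1 : ∀ e, e ≤ d → w e = 1 := by
    intro e he
    simp [hwdef, Nat.sub_eq_zero_of_le he]
  have hwmono : ∀ a b, a ≤ b → w a ≤ w b := by
    intro a b hab
    simp only [hwdef]
    gcongr
    exacts [hw _, norm_natCast_le_of_dvd (Nat.factorial_dvd_factorial (by omega))]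
  have hwmul : ∀ a b, 1 ≤ a → 1 ≤ b → w a * w b ≤ w (a + b - 1) := by
    intro a b ha hb
    simp only [hwdef]
    rw [← mul_inv, ← norm_mul, ← Nat.cast_mul]
    gcongr
    exacts [hw _, norm_natCast_le_of_dvd (Nat.factorial_sub_mul_factorial_sub_dvd hd1 ha hb)]
  have key : ∀ e, ‖coeff (e + 1) a‖ ≤ (R * S) ^ e * w e := by
    intro e
    induction e using Nat.strong_induction_on with
    | _ e ih =>
      rcases le_or_gt e d with he | he
      · rw [hw1 e he, mul_one]
        rcases Nat.eq_zero_or_pos e with rfl | he0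
        · simp [ha1]
        have h1 : ‖coeff (e + 1) a‖ ≤ S := by
          have := Finset.single_le_sum (f := fun i => ‖coeff i a‖)
            (fun i _ => norm_nonneg _) (Finset.mem_range.2 (show e + 1 < d + 2 by omega))
          linarith
        exact h1.trans ((le_mul_of_one_le_left (by positivity) hR).trans
          (le_self_pow₀ hRS1 (by omega)))
      obtain ⟨e, rfl⟩ : ∃ e', e = e' + 1 := ⟨e - 1, by omega⟩
      set t := trunc (e + 1 + 1) a with ht
      have hC : 0 ≤ w e * (‖ρ‖ * (R * S) ^ (e + 1)) :=
        mul_nonneg (hwpos e).le (by positivity)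
      have hterm : ∀ j < e + 1 + 1, ‖t.coeff j‖ * R ^ (e + 1 + 1 + d - j) ≤
          w e * (‖ρ‖ * (R * S) ^ (e + 1)) := by
        intro j hj
        rw [coeff_trunc, if_pos hj]
        rcases j with _ | j
        · rw [ha0, norm_zero, zero_mul]; exact hC
        have hexp : e + 1 + 1 + d - (j + 1) = e + 1 + d - j := by omega
        rw [hexp]
        calc ‖coeff (j + 1) a‖ * R ^ (e + 1 + d - j)
            ≤ ((R * S) ^ j * w e) * R ^ (e + 1 + d - j) := by
              gcongr
              refine (ih j (by omega)).trans ?_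
              gcongr
              exact hwmono _ _ (by omega)
          _ = w e * ((R * S) ^ j * R ^ (e + 1 + d - j)) := by ring
          _ ≤ _ := by
              refine mul_le_mul_of_nonneg_left ?_ (hwpos e).le
              exact mul_pow_mul_pow_le hR hS1 hρ'.le hd (by omega)
      have h1 := norm_coeff_aeval_le hφ hC (degree_trunc_lt a _) hterm
      have h2 : coeff (e + 1 + 1 + d) (t : PowerSeries K) = 0 := by
        rw [Polynomial.coeff_coe, coeff_trunc, if_neg (by omega)]
      set τ : PowerSeries K := mk fun i => t.coeff (i + 1) with hτ
      have htτ : (t : PowerSeries K) = X * τ := by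
        ext i
        rcases i with _ | i
        · rw [Polynomial.coeff_coe, coeff_trunc, if_pos (by omega), ha0]
          simp
        · simp [hτ, coeff_succ_X_mul]
      -- The coefficient of index e+1 of `τ` is zero, so the weight may be capped at `w e`. This
      -- leaves the new divisor to turn `w e` into `w (e + 1)`.
      have hτb : ∀ i ≤ e + 1, ‖coeff i τ‖ ≤ (R * S) ^ i * w (min i e) := by
        intro i hi
        rw [hτ, coeff_mk, coeff_trunc]
        split_ifs with h
        · rw [min_eq_left (by omega)]
          exact ih i (by omega)
        · rw [norm_zero]
          exact mul_nonneg (by positivity) (hwpos _).le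
      have hvmul : ∀ a b, a + b ≤ e + 1 → ((R * S) ^ a * w (min a e)) *
          ((R * S) ^ b * w (min b e)) ≤ (R * S) ^ (a + b) * w (min (a + b) e) := by
        intro a b hab
        have : w (min a e) * w (min b e) ≤ w (min (a + b) e) := by
          rcases Nat.eq_zero_or_pos a with rfl | ha
          · simp [hw1 0 (Nat.zero_le _)]
          rcases Nat.eq_zero_or_pos b with rfl | hb
          · simp [hw1 0 (Nat.zero_le _)]
          rw [min_eq_left (show a ≤ e by omega), min_eq_left (show b ≤ e by omega)]
          exact (hwmul a b ha hb).trans (hwmono _ _ (by omega))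
        calc _ = (R * S) ^ (a + b) * (w (min a e) * w (min b e)) := by rw [pow_add]; ring
          _ ≤ _ := by gcongr
      have hpow := fun j => norm_coeff_pow_le (v := fun i => (R * S) ^ i * w (min i e))
        (M := e + 1) (by simp [hw1 0 (Nat.zero_le _)]) hvmul hτb j
      have h3 : ‖coeff (e + 1 + 1 + d) (C ρ * (t : PowerSeries K) ^ (d + 1))‖ ≤
          w e * (‖ρ‖ * (R * S) ^ (e + 1)) := by
        rw [coeff_C_mul, htτ, mul_pow, coeff_X_pow_mul', if_pos (by omega), norm_mul]
        have := hpow (d + 1) (e + 1) le_rfl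
        simp only [min_eq_right (Nat.le_succ e)] at this
        rw [show e + 1 + 1 + d - (d + 1) = e + 1 by omega]
        calc _ ≤ ‖ρ‖ * ((R * S) ^ (e + 1) * w e) := by gcongr
          _ = _ := by ring
      -- Only the coefficient of index e+1-d ≤ e of a power of `τ` enters, so a factor `R * S`
      -- remains to absorb `μ`.
      have h4 : ‖coeff (e + 1 + 1 + d) (C μ * (t : PowerSeries K) ^ (2 * (d + 1) - 1))‖ ≤
          w e * (‖ρ‖ * (R * S) ^ (e + 1)) := by
        rw [coeff_C_mul, htτ, mul_pow, coeff_X_pow_mul', if_pos (by omega), norm_mul]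
        have := hpow (2 * (d + 1) - 1) (e + 1 - d) (by omega)
        rw [show e + 1 + 1 + d - (2 * (d + 1) - 1) = e + 1 - d by omega]
        have h5 : (R * S) ^ (e + 1 - d) ≤ (R * S) ^ e := pow_le_pow_right₀ hRS1 (by omega)
        have h6 : w (min (e + 1 - d) e) ≤ w e := hwmono _ _ (by omega)
        have h7 := (hwpos e).le
        calc _ ≤ (‖ρ‖ * (R * S)) * ((R * S) ^ e * w e) := by
              refine mul_le_mul hμ (this.trans ?_) (norm_nonneg _) (by positivity)
              exact mul_le_mul h5 h6 (hwpos _).le (by positivity)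
          _ = _ := by ring
      have h5 : ‖coeff (e + 1 + 1) a‖ * (‖((e + 1 - d : ℕ) : K)‖ * ‖ρ‖) ≤
          w e * (‖ρ‖ * (R * S) ^ (e + 1)) := by
        have hcast : ((e + 1 - d : ℕ) : K) = ((e + 1 + 1 : ℕ) : K) - ((d + 1 : ℕ) : K) := by
          rw [← Nat.cast_sub (by omega)]
          congr 1
          omega
        rw [hcast, ← norm_mul, ← norm_mul, ha (e + 1 + 1) (by omega), norm_neg, conjDefect,
          map_sub, map_add, map_add, h2, zero_add]
        exact (norm_sub_le_max_of_isUltrametricDist _ _).trans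
          (max_le h1 ((IsUltrametricDist.norm_add_le_max _ _).trans (max_le h3 h4)))
      have hn0 : 0 < ‖((e + 1 - d : ℕ) : K)‖ :=
        norm_pos_iff.2 (Nat.cast_ne_zero.2 (by omega))
      have hfacn : w (e + 1) = ‖((e + 1 - d : ℕ) : K)‖⁻¹ * w e := by
        simp only [hwdef]
        rw [← mul_inv, ← norm_mul, ← Nat.cast_mul, show e - d = e + 1 - d - 1 by omega,
          Nat.mul_factorial_pred (by omega)]
      rw [hfacn]
      refine le_of_mul_le_mul_right (h5.trans_eq ?_) (mul_pos hn0 hρ')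
      field_simp
  have hRc : 1 ≤ R * S / c := by
    rw [le_div_iff₀ hc]; linarith
  refine ⟨R * S / c, by positivity, fun n => ?_⟩
  rcases n with _ | e
  · simp [ha0]
  refine (key e).trans (le_trans ?_ (pow_le_pow_right₀ hRc e.le_succ))
  rw [div_pow, div_eq_mul_inv]
  gcongr
  exact inv_anti₀ (by positivity) ((pow_le_pow_of_le_one hc.le hc1 (Nat.sub_le e d)).trans (hfac _))

end ConjugacyBounds

/-! ### Formal conjugacy and formal cohomological equation -/

section FormalSolutions

variable {K : Type*} [Field K]

open Polynomial in
theorem exists_powerSeries_conjDefect [CharZero K] {f : PowerSeries K} {ρ : K} (hρ : ρ ≠ 0)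
    {m : ℕ} (hm : 2 ≤ m)
    (hf : PowerSeries.X ^ (m + 1) ∣ f - PowerSeries.X - PowerSeries.C ρ * PowerSeries.X ^ m) :
    ∃ (μ : K) (a : PowerSeries K), PowerSeries.coeff 0 a = 0 ∧ PowerSeries.coeff 1 a = 1 ∧
      ∀ n, m < n →
        PowerSeries.X ^ (n + (m - 1)) ∣ conjDefect f ρ μ m (PowerSeries.trunc n a) ∧
        PowerSeries.coeff n a * (((n : K) - m) * ρ) =
          - PowerSeries.coeff (n + (m - 1)) (conjDefect f ρ μ m (PowerSeries.trunc n a)) := by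
  have hC : ∀ (n : ℕ) (c : K), ((monomial n c : K[X]) : PowerSeries K) =
      PowerSeries.C c * PowerSeries.X ^ n := by
    intro n c
    rw [← C_mul_X_pow_eq_monomial]
    simp
  -- The slot of degree m, useless for the conjugacy because of the resonance, stores μ instead.
  -- Changing μ alters the defect by -c·x^(2m-1) to leading order, whence δ m = -1.
  let E : K[X] → PowerSeries K := fun t =>
    conjDefect f ρ (t.coeff m) m (t - monomial m (t.coeff m))
  let δ : ℕ → K := fun n => if n = m then -1 else ((n : K) - m) * ρ
  have ht₀ : (X : K[X]).degree < ((2 : ℕ) : WithBot ℕ) := by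
    rw [degree_X]
    exact_mod_cast one_lt_two
  have hE₀ : PowerSeries.X ^ (2 + (m - 1)) ∣ E X := by
    have hX : (X : K[X]).coeff m = 0 := by rw [coeff_X, if_neg (by omega)]
    simp only [E, hX, map_zero, sub_zero, conjDefect, zero_mul, add_zero, aeval_X, coe_X]
    rw [show 2 + (m - 1) = m + 1 by omega]
    simpa [sub_sub] using hf
  have hδ : ∀ n, 2 ≤ n → δ n ≠ 0 := by
    intro n _
    simp only [δ]
    split_ifs with h
    · simp
    · exact mul_ne_zero (sub_ne_zero.2 (by exact_mod_cast h)) hρ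
  have hE : ∀ n : ℕ, 2 ≤ n → ∀ t : K[X], X ^ 2 ∣ t - X → t.degree < n → ∀ c,
      PowerSeries.X ^ (n + (m - 1) + 1) ∣ E (t + monomial n c) - E t -
        PowerSeries.C (c * δ n) * PowerSeries.X ^ (n + (m - 1)) := by
    intro n hn t ht htn c
    have htC : PowerSeries.X ^ 2 ∣ (t : PowerSeries K) - PowerSeries.X := by
      obtain ⟨s, hs⟩ := ht
      exact ⟨s, by simpa using congrArg (fun p : K[X] => (p : PowerSeries K)) hs⟩
    have htn0 : t.coeff n = 0 := coeff_eq_zero_of_degree_lt htn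
    rcases eq_or_ne n m with rfl | hnm
    · simp only [E, δ, if_true, coeff_add, htn0, coeff_monomial_same, zero_add, map_zero, sub_zero,
        add_sub_cancel_right]
      obtain ⟨s, hs⟩ := htC
      have h1 : (t : PowerSeries K) = PowerSeries.X * (1 + PowerSeries.X * s) := by
        linear_combination hs
      obtain ⟨v, hv⟩ : PowerSeries.X ∣ (1 + PowerSeries.X * s) ^ (2 * n - 1) - 1 := by
        refine dvd_trans ⟨s, ?_⟩ (sub_one_dvd_pow_sub_one (1 + PowerSeries.X * s) _)
        ring
      refine ⟨- (PowerSeries.C c * v), ?_⟩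
      have h2 : n + (n - 1) = 2 * n - 1 := by omega
      have h3 : (t : PowerSeries K) ^ (2 * n - 1) =
          PowerSeries.X ^ (2 * n - 1) * (1 + PowerSeries.X * v) := by
        rw [h1, mul_pow]
        linear_combination PowerSeries.X ^ (2 * n - 1) * hv
      rw [h2, pow_succ]
      simp only [conjDefect, map_zero, zero_mul, add_zero, h3, map_mul, map_neg, map_one]
      ring
    · have hco : (t + monomial n c).coeff m = t.coeff m := by
        simp [coeff_monomial, hnm]
      simp only [E, δ, if_neg hnm, hco]
      set μ := t.coeff m
      set u := t - monomial m μ with hu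
      have hu' : t + monomial n c - monomial m μ = u + monomial n c := by rw [hu]; ring
      have huX : PowerSeries.X ^ 2 ∣ (u : PowerSeries K) - PowerSeries.X := by
        rw [hu, coe_sub, hC, sub_right_comm]
        exact dvd_sub htC ((pow_dvd_pow _ hm).mul_left _)
      have h1 := (X_pow_dvd_pow_sub hm hf n (by omega)).mul_left (PowerSeries.C c)
      have h2 := (X_pow_dvd_add_pow_sub huX n hn c m (by omega)).mul_left (PowerSeries.C ρ)
      have h3 := (X_pow_dvd_add_pow_sub huX n hn c (2 * m - 1) (by omega)).mul_left
        (PowerSeries.C μ)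
      rw [show n + (m - 1) + 1 = n + m by omega] at h1 ⊢
      have h4 : (PowerSeries.X : PowerSeries K) ^ (n + m) ∣
          PowerSeries.C μ * (PowerSeries.C (((2 * m - 1 : ℕ) : K) * c) *
            PowerSeries.X ^ (n + (2 * m - 1 - 1))) :=
        ((pow_dvd_pow _ (by omega)).mul_left _).mul_left _
      have h5 := (pow_dvd_pow (PowerSeries.X : PowerSeries K)
        (show n + m ≤ n + (2 * m - 1) by omega)).trans h3
      have h6 := dvd_sub (dvd_sub (dvd_sub h1 h2) h5) h4
      refine h6.trans (dvd_of_eq ?_)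
      rw [hu']
      simp only [conjDefect, map_add, coe_add, hC, aeval_monomial, map_mul, map_sub,
        PowerSeries.algebraMap_apply, Algebra.algebraMap_self, RingHom.id_apply]
      ring
  obtain ⟨b, hb2, hb⟩ := exists_powerSeries_of_triangular E (m - 1) 2 δ X ht₀ hE₀ hδ hE
  have hb0 : ∀ i < 2, PowerSeries.coeff i b = (X : K[X]).coeff i := by
    intro i hi
    rw [← hb2, PowerSeries.coeff_trunc, if_pos hi]
  refine ⟨PowerSeries.coeff m b,
    b - PowerSeries.C (PowerSeries.coeff m b) * PowerSeries.X ^ m, ?_, ?_, fun n hn => ?_⟩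
  · rw [map_sub, hb0 0 (by omega), PowerSeries.coeff_C_mul, PowerSeries.coeff_X_pow,
      if_neg (by omega)]
    simp
  · simp [hb0 1 (by omega), PowerSeries.coeff_X_pow, show 1 ≠ m by omega]
  · have htr : PowerSeries.trunc n
        (b - PowerSeries.C (PowerSeries.coeff m b) * PowerSeries.X ^ m) =
        PowerSeries.trunc n b - monomial m (PowerSeries.coeff m b) := by
      ext i
      rw [PowerSeries.coeff_trunc, coeff_sub, PowerSeries.coeff_trunc, coeff_monomial]
      rcases eq_or_ne m i with rfl | hi
      · simp [hn]
      · simp [hi, PowerSeries.coeff_X_pow, hi.symm]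
    have hm' : (PowerSeries.trunc n b).coeff m = PowerSeries.coeff m b := by
      rw [PowerSeries.coeff_trunc, if_pos hn]
    have h := hb n (by omega)
    simp only [E, δ, hm', if_neg hn.ne'] at h
    rw [htr]
    refine ⟨h.1, ?_⟩
    rw [← h.2]
    simp [PowerSeries.coeff_X_pow, hn.ne']

open Polynomial in
-- The divisors nρ never vanish for n ≥ 1. The initial guess 1 has defect -q, which must already
-- have order 1+(m-1) = m.
theorem exists_powerSeries_cohomological [CharZero K] {f q : PowerSeries K} {ρ : K} (hρ : ρ ≠ 0)
    {m : ℕ} (hm : 2 ≤ m)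
    (hf : PowerSeries.X ^ (m + 1) ∣ f - PowerSeries.X - PowerSeries.C ρ * PowerSeries.X ^ m)
    (hq : PowerSeries.X ^ m ∣ q) :
    ∃ a : PowerSeries K, PowerSeries.coeff 0 a = 1 ∧ ∀ n, 1 ≤ n →
      PowerSeries.X ^ (n + (m - 1)) ∣ aeval f (PowerSeries.trunc n a) -
        (PowerSeries.trunc n a : PowerSeries K) - q * (PowerSeries.trunc n a : PowerSeries K) ∧
      PowerSeries.coeff n a * (n * ρ) = - PowerSeries.coeff (n + (m - 1))
        (aeval f (PowerSeries.trunc n a) - (PowerSeries.trunc n a : PowerSeries K) -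
          q * (PowerSeries.trunc n a : PowerSeries K)) := by
  let E : K[X] → PowerSeries K :=
    fun t => aeval f t - (t : PowerSeries K) - q * (t : PowerSeries K)
  have ht₀ : (1 : K[X]).degree < ((1 : ℕ) : WithBot ℕ) := by
    rw [degree_one]
    exact_mod_cast one_pos
  have hE₀ : PowerSeries.X ^ (1 + (m - 1)) ∣ E 1 := by
    rw [show 1 + (m - 1) = m by omega]
    simpa [E] using hq
  have hδ : ∀ n : ℕ, 1 ≤ n → (n : K) * ρ ≠ 0 := by
    intro n hn
    exact mul_ne_zero (Nat.cast_ne_zero.2 (by omega)) hρ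
  have hE : ∀ n : ℕ, 1 ≤ n → ∀ t : K[X], X ^ 1 ∣ t - 1 → t.degree < n → ∀ c,
      PowerSeries.X ^ (n + (m - 1) + 1) ∣ E (t + monomial n c) - E t -
        PowerSeries.C (c * (n * ρ)) * PowerSeries.X ^ (n + (m - 1)) := by
    intro n hn t _ _ c
    have hC : ((monomial n c : K[X]) : PowerSeries K) = PowerSeries.C c * PowerSeries.X ^ n := by
      rw [← C_mul_X_pow_eq_monomial]
      simp
    have h1 := (X_pow_dvd_pow_sub hm hf n hn).mul_left (PowerSeries.C c)
    have h2 : PowerSeries.X ^ (n + (m - 1) + 1) ∣ q * (PowerSeries.C c * PowerSeries.X ^ n) := by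
      rw [show n + (m - 1) + 1 = m + n by omega, pow_add]
      exact mul_dvd_mul hq (Dvd.intro_left _ rfl)
    refine (dvd_sub h1 h2).trans (dvd_of_eq ?_)
    simp only [E, map_add, coe_add, hC, aeval_monomial, map_mul,
      PowerSeries.algebraMap_apply, Algebra.algebraMap_self, RingHom.id_apply]
    ring
  obtain ⟨a, ha1, ha⟩ := exists_powerSeries_of_triangular E (m - 1) 1 _ 1 ht₀ hE₀ hδ hE
  refine ⟨a, ?_, ha⟩
  have := congrArg (fun p => Polynomial.coeff p 0) ha1
  simpa [PowerSeries.coeff_trunc] using this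

end FormalSolutions

/-! ### From formal to analytic solutions -/

section AnalyticSolutions

variable {K : Type*} [NontriviallyNormedField K]

theorem HasTaylor.apply_zero {u : K → K} {p : PowerSeries K} (h : HasTaylor u p) :
    u 0 = PowerSeries.coeff 0 p := by
  obtain ⟨c, hc⟩ := (h 1).bound
  have h0 := hc.self_of_nhds
  rw [pow_one, norm_zero, mul_zero, norm_le_zero_iff, sub_eq_zero] at h0
  rw [h0, ← Polynomial.coeff_zero_eq_eval_zero, PowerSeries.coeff_trunc, if_pos one_pos]

theorem HasTaylor.hasDerivAt {u : K → K} {p : PowerSeries K} (h : HasTaylor u p) :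
    HasDerivAt u (PowerSeries.coeff 1 p) 0 := by
  rw [hasDerivAt_iff_isLittleO]
  have h2 := (h 2).trans_isLittleO (isLittleO_pow_id (𝕜 := K) one_lt_two)
  refine (h2.congr_left fun x => ?_).congr_right fun x => (sub_zero x).symm
  rw [h.apply_zero, ← Polynomial.eval₂_id, PowerSeries.eval₂_trunc_eq_sum_range]
  simp [Finset.sum_range_succ, sub_sub, mul_comm]

theorem PowerSeries.X_pow_dvd_sub_trunc (a : PowerSeries K) (n : ℕ) :
    (X : PowerSeries K) ^ n ∣ a - (trunc n a : PowerSeries K) := by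
  rw [X_pow_dvd_iff]
  intro i hi
  rw [map_sub, Polynomial.coeff_coe, coeff_trunc, if_pos hi, sub_self]

theorem isBigO_pow_pow_of_le {m n : ℕ} (h : m ≤ n) :
    (fun x : K => x ^ n) =O[𝓝 0] (fun x : K => x ^ m) := by
  simpa using Polynomial.isBigO_eval_of_X_pow_dvd (K := K) (P := Polynomial.X ^ n) (N := m)
    (pow_dvd_pow _ h)

/-- To show that `u ∘ f` and `w` agree as germs, it is enough to check that the truncations of `u`
satisfy this to high order. -/
theorem AnalyticAt.eventually_comp_eq_of_hasTaylor {u f w : K → K} {a p q : PowerSeries K}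
    (hu : AnalyticAt K u 0) (hua : HasTaylor u a) (hf : AnalyticAt K f 0) (hfp : HasTaylor f p)
    (hp : PowerSeries.X ∣ p) (hw : AnalyticAt K w 0) (hwq : HasTaylor w q) (n₀ : ℕ)
    (h : ∀ n, n₀ ≤ n →
      PowerSeries.X ^ n ∣ Polynomial.aeval p (PowerSeries.trunc n a) - q) :
    ∀ᶠ x in 𝓝 (0 : K), u (f x) = w x := by
  have hf0 : f 0 = 0 := by
    rw [hfp.apply_zero]
    simpa using PowerSeries.X_dvd_iff.1 hp
  have hfO : f =O[𝓝 0] (fun x : K => x) := by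
    simpa using hfp.isBigO_of_X_pow_dvd (N := 1) (by simpa using hp)
  have hft : Tendsto f (𝓝 0) (𝓝 0) := by
    simpa [hf0] using hf.continuousAt.tendsto
  have hcomp : AnalyticAt K (fun x => u (f x)) 0 := by
    have hu' : AnalyticAt K u (f 0) := by rwa [hf0]
    exact hu'.comp hf
  have hz := (hcomp.sub hw).eventually_eq_zero_of_isBigO_pow fun N => by
    have hn : n₀ ≤ max N n₀ := le_max_right _ _
    set n := max N n₀
    have h1 : (fun x => u (f x) - (PowerSeries.trunc n a).eval (f x)) =O[𝓝 0]
        (fun x : K => x ^ n) := ((hua n).comp_tendsto hft).trans (hfO.pow n)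
    have h2 := ((hfp.aeval (PowerSeries.trunc n a)).sub hwq).isBigO_of_X_pow_dvd (h n hn)
    refine ((h1.add h2).congr_left fun x => ?_).trans (isBigO_pow_pow_of_le (le_max_left N n₀))
    simp
  filter_upwards [hz] with x hx
  exact sub_eq_zero.1 hx

theorem AnalyticAt.exists_hasTaylor_of_tangent {f : K → K} (hf : AnalyticAt K f 0) {ρ : K}
    {m : ℕ} (hm : 2 ≤ m)
    (hfm : (fun x : K => f x - (x + ρ * x ^ m)) =O[𝓝 0] (fun x : K => x ^ (m + 1))) :
    ∃ (φ : PowerSeries K) (R : ℝ), 1 ≤ R ∧ HasTaylor f (PowerSeries.X * φ) ∧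
      (∀ i, ‖PowerSeries.coeff i φ‖ ≤ R ^ i) ∧
      PowerSeries.X ^ (m + 1) ∣
        PowerSeries.X * φ - PowerSeries.X - PowerSeries.C ρ * PowerSeries.X ^ m := by
  obtain ⟨p, hp, R, hR, hb⟩ := hf.exists_hasTaylor
  have hT := hp.sub (HasTaylor.polynomial (Polynomial.X + Polynomial.C ρ * Polynomial.X ^ m))
  have hd : PowerSeries.X ^ (m + 1) ∣
      p - PowerSeries.X - PowerSeries.C ρ * PowerSeries.X ^ m := by
    have := hT.X_pow_dvd_of_isBigO (N := m + 1) (by simpa using hfm)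
    simpa [sub_sub] using this
  have hco := PowerSeries.X_pow_dvd_iff.1 hd
  have h0 : PowerSeries.coeff 0 p = 0 := by
    have := hco 0 (by omega)
    rw [map_sub, map_sub, PowerSeries.coeff_C_mul, PowerSeries.coeff_X_pow,
      if_neg (by omega)] at this
    simpa using this
  have h1 : PowerSeries.coeff 1 p = 1 := by
    have := hco 1 (by omega)
    rw [map_sub, map_sub, PowerSeries.coeff_C_mul, PowerSeries.coeff_X_pow,
      if_neg (by omega), PowerSeries.coeff_one_X, mul_zero, sub_zero] at this
    exact sub_eq_zero.1 this
  obtain ⟨φ, rfl⟩ := PowerSeries.X_dvd_iff.2 (by simpa using h0)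
  -- Removing the factor X shifts indices, and i+1 ≤ 2i for i ≥ 1 explains the square; at i = 0 the
  -- coefficient is 1.
  refine ⟨φ, R ^ 2, one_le_pow₀ hR, hp, fun i => ?_, hd⟩
  rw [← PowerSeries.coeff_succ_X_mul]
  rcases i with _ | i
  · simp [h1]
  · refine (hb _ (by omega)).trans ?_
    rw [← pow_mul]
    exact pow_le_pow_right₀ hR (by omega)

/-- A one-variable analytic germ with derivative `1` has an analytic local inverse. -/
theorem AnalyticAt.exists_local_inverse [CompleteSpace K] [CharZero K] {h : K → K}
    (hh : AnalyticAt K h 0) (h0 : h 0 = 0) (h1 : HasDerivAt h 1 0) :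
    ∃ s : K → K, AnalyticAt K s 0 ∧ s 0 = 0 ∧ (∀ᶠ x in 𝓝 (0 : K), h (s x) = x) ∧
      ∀ᶠ x in 𝓝 (0 : K), s (h x) = x := by
  have hd : deriv h 0 ≠ 0 := by rw [h1.deriv]; exact one_ne_zero
  have hs := hh.hasStrictDerivAt
  refine ⟨hs.localInverse _ _ _ hd, ?_, ?_, ?_, ?_⟩
  · simpa [h0] using hh.analyticAt_localInverse hd
  · have := HasStrictFDerivAt.localInverse_apply_image (hs.hasStrictFDerivAt_equiv hd)
    rwa [h0] at this
  · have := HasStrictFDerivAt.eventually_right_inverse (hs.hasStrictFDerivAt_equiv hd)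
    rwa [h0] at this
  · exact HasStrictFDerivAt.eventually_left_inverse (hs.hasStrictFDerivAt_equiv hd)

variable [CompleteSpace K] [IsUltrametricDist K] [CharZero K]

/-- An analytic germ tangent to the identity is analytically conjugate to its polynomial
normal form. -/
theorem AnalyticAt.exists_semiconj_normalForm {f : K → K} (hf : AnalyticAt K f 0) {ρ : K}
    (hρ : ρ ≠ 0) {m : ℕ} (hm : 2 ≤ m)
    (hfm : (fun x : K => f x - (x + ρ * x ^ m)) =O[𝓝 0] (fun x : K => x ^ (m + 1))) :
    ∃ (μ : K) (h : K → K), AnalyticAt K h 0 ∧ h 0 = 0 ∧ HasDerivAt h 1 0 ∧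
      ∀ᶠ x in 𝓝 (0 : K), h (f x) = h x + ρ * h x ^ m + μ * h x ^ (2 * m - 1) := by
  obtain ⟨φ, R, hR, hT, hφ, hd⟩ := hf.exists_hasTaylor_of_tangent hm hfm
  obtain ⟨μ, a, ha0, ha1, ha⟩ := exists_powerSeries_conjDefect hρ hm hd
  obtain ⟨R', hR', hb⟩ := PowerSeries.norm_coeff_le_of_conjDefect hR hφ hρ hm ha0 ha1
    fun n hn => (ha n hn).2
  obtain ⟨h, hh, hha⟩ := PowerSeries.exists_analyticAt_hasTaylor a hR' hb
  refine ⟨μ, h, hh, by rw [hha.apply_zero, ha0], by simpa [ha1] using hha.hasDerivAt, ?_⟩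
  have hwq := (hha.add ((HasTaylor.const ρ).mul (hha.pow m))).add
    ((HasTaylor.const μ).mul (hha.pow (2 * m - 1)))
  have hw : AnalyticAt K (fun x => h x + ρ * h x ^ m + μ * h x ^ (2 * m - 1)) 0 :=
    (hh.add (analyticAt_const.mul (hh.pow m))).add (analyticAt_const.mul (hh.pow _))
  refine AnalyticAt.eventually_comp_eq_of_hasTaylor hh hha hf hT (Dvd.intro _ rfl) hw hwq (m + 1)
    fun n hn => ?_
  have h1 := (pow_dvd_pow (PowerSeries.X : PowerSeries K) (Nat.le_add_right n (m - 1))).trans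
    (ha n hn).1
  have h2 := PowerSeries.X_pow_dvd_sub_trunc a n
  have h3 := (h2.trans (sub_dvd_pow_sub_pow _ _ m)).mul_left (PowerSeries.C ρ)
  have h4 := (h2.trans (sub_dvd_pow_sub_pow _ _ (2 * m - 1))).mul_left (PowerSeries.C μ)
  refine (dvd_sub (dvd_sub (dvd_sub h1 h2) h3) h4).trans (dvd_of_eq ?_)
  rw [conjDefect]
  ring

/-- Solution of a multiplicative cohomological equation over a germ tangent to the identity. -/
theorem AnalyticAt.exists_cohomological {f q : K → K} (hf : AnalyticAt K f 0) {ρ : K}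
    (hρ : ρ ≠ 0) {m : ℕ} (hm : 2 ≤ m)
    (hfm : (fun x : K => f x - (x + ρ * x ^ m)) =O[𝓝 0] (fun x : K => x ^ (m + 1)))
    (hq : AnalyticAt K q 0) (hqm : q =O[𝓝 0] (fun x : K => x ^ m)) :
    ∃ k : K → K, AnalyticAt K k 0 ∧ k 0 = 1 ∧
      ∀ᶠ x in 𝓝 (0 : K), k (f x) = (1 + q x) * k x := by
  obtain ⟨φ, R, hR, hT, hφ, hd⟩ := hf.exists_hasTaylor_of_tangent hm hfm
  obtain ⟨q', hq', S, hS, hqb⟩ := hq.exists_hasTaylor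
  have hdq := hq'.X_pow_dvd_of_isBigO hqm
  obtain ⟨a, ha0, ha⟩ := exists_powerSeries_cohomological hρ hm hd hdq
  have hqb' : ∀ i, ‖PowerSeries.coeff i q'‖ ≤ (max R S) ^ i := by
    intro i
    rcases Nat.eq_zero_or_pos i with rfl | hi
    · rw [PowerSeries.X_pow_dvd_iff.1 hdq 0 (by omega)]
      simp
    · exact (hqb i hi).trans (pow_le_pow_left₀ (by linarith) (le_max_right _ _) i)
  obtain ⟨R', hR', hb⟩ := PowerSeries.norm_coeff_le_of_linear_recursion
    (hR.trans (le_max_left R S))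
    (fun i => (hφ i).trans (pow_le_pow_left₀ (by linarith) (le_max_left _ _) i)) hqb' hρ ha0
    fun n hn => (ha n hn).2
  obtain ⟨k, hk, hka⟩ := PowerSeries.exists_analyticAt_hasTaylor a hR' hb
  refine ⟨k, hk, by rw [hka.apply_zero, ha0], ?_⟩
  refine AnalyticAt.eventually_comp_eq_of_hasTaylor hk hka hf hT (Dvd.intro _ rfl)
    ((analyticAt_const.add hq).mul hk) (((HasTaylor.const 1).add hq').mul hka) 1 fun n hn => ?_
  have h1 := (pow_dvd_pow (PowerSeries.X : PowerSeries K) (Nat.le_add_right n (m - 1))).trans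
    (ha n hn).1
  have h2 := (PowerSeries.X_pow_dvd_sub_trunc a n).mul_left (1 + q')
  refine (dvd_sub h1 h2).trans (dvd_of_eq ?_)
  rw [map_one]
  ring

end AnalyticSolutions

/-! ### Skew products and the normal form -/

theorem IsAnalyticLocalInverse.skewProduct {K : Type*} [NontriviallyNormedField K]
    [CompleteSpace K] {h k s : K → K} (hs : AnalyticAt K s 0) (hs0 : s 0 = 0)
    (hhs : ∀ᶠ x in 𝓝 (0 : K), h (s x) = x) (hsh : ∀ᶠ x in 𝓝 (0 : K), s (h x) = x)
    (hk : AnalyticAt K k 0) (hk0 : k 0 ≠ 0) :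
    IsAnalyticLocalInverse (fun p : K × K => (h p.1, p.2 * k p.1))
      (fun p : K × K => (s p.1, p.2 / k (s p.1))) := by
  have hfst : Tendsto (Prod.fst : K × K → K) (𝓝 0) (𝓝 0) := continuous_fst.tendsto 0
  have hks : AnalyticAt K (fun x => k (s x)) 0 := by
    have hk' : AnalyticAt K k (s 0) := by rwa [hs0]
    exact hk'.comp hs
  have hkne : ∀ᶠ x in 𝓝 (0 : K), k x ≠ 0 := hk.continuousAt.eventually_ne hk0
  have hksne : ∀ᶠ x in 𝓝 (0 : K), k (s x) ≠ 0 :=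
    hks.continuousAt.eventually_ne (by simpa [hs0] using hk0)
  have hfstA : AnalyticAt K (Prod.fst : K × K → K) 0 := analyticAt_fst
  refine ⟨?_, ?_, ?_, ?_⟩
  · have h1 : AnalyticAt K (fun p : K × K => s p.1) 0 := AnalyticAt.comp (g := s) hs hfstA
    have h2 : AnalyticAt K (fun p : K × K => k (s p.1)) 0 :=
      AnalyticAt.comp (g := fun x => k (s x)) hks hfstA
    exact h1.prod (analyticAt_snd.div h2 (by simpa [hs0] using hk0))
  · simp [hs0]
  · filter_upwards [hfst.eventually hhs, hfst.eventually hksne] with p h1 h2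
    ext
    · exact h1
    · exact div_mul_cancel₀ _ h2
  · filter_upwards [hfst.eventually hsh, hfst.eventually hkne] with p h1 h2
    ext
    · exact h1
    · simp only [h1]
      exact mul_div_cancel_right₀ _ h2

theorem theorem1p2 {K : Type*} [NontriviallyNormedField K] [CompleteSpace K]
    [IsUltrametricDist K] [CharZero K]
    (lam : K) (hlam : lam ≠ 0) (m : ℕ) (hm : 2 ≤ m) (rho : K) (hrho : rho ≠ 0)
    (f g : K → K) (hf : AnalyticAt K f 0) (hg : AnalyticAt K g 0)
    (hfm : (fun x : K => f x - (x + rho * x ^ m)) =O[𝓝 0] (fun x : K => x ^ (m + 1)))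
    (hg0 : g 0 = 0) :
    ∃ (r : Polynomial K) (mu : K) (h k : K → K),
      r.eval 0 = 0 ∧ r.degree < (m : WithBot ℕ) ∧
      AnalyticAt K h 0 ∧ h 0 = 0 ∧ HasDerivAt h 1 0 ∧
      AnalyticAt K k 0 ∧ k 0 = 1 ∧
      AnalyticallyConjugates
        (fun p : K × K => (h p.1, p.2 * k p.1))
        (fun p : K × K => (f p.1, lam * p.2 * (1 + g p.1)))
        (fun p : K × K =>
          (p.1 + rho * p.1 ^ m + mu * p.1 ^ (2 * m - 1), lam * p.2 * (1 + r.eval p.1))) := by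
  obtain ⟨mu, h, hh, hh0, hh1, hconj⟩ := hf.exists_semiconj_normalForm hrho hm hfm
  obtain ⟨s, hs, hs0, hhs, hsh⟩ := hh.exists_local_inverse hh0 hh1
  have hgs : AnalyticAt K (fun x => g (s x)) 0 := by
    have hg' : AnalyticAt K g (s 0) := by rwa [hs0]
    exact hg'.comp hs
  have hht : Tendsto h (𝓝 0) (𝓝 0) := by simpa [hh0] using hh.continuousAt.tendsto
  have hst : Tendsto s (𝓝 0) (𝓝 0) := by simpa [hs0] using hs.continuousAt.tendsto
  obtain ⟨p, hp, -⟩ := hgs.exists_hasTaylor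
  -- With `r` the Taylor polynomial of g∘h⁻¹, the germ r∘h agrees with g up to O(x^m).
  set r := PowerSeries.trunc m p with hr
  have hr0 : r.eval 0 = 0 := by
    rw [← Polynomial.coeff_zero_eq_eval_zero, hr, PowerSeries.coeff_trunc, if_pos (by omega),
      ← hp.apply_zero, hs0, hg0]
  have hhO : h =O[𝓝 0] (fun x : K => x) := by
    simpa [hh0] using hh1.differentiableAt.isBigO_sub
  have hgr : (fun x => g x - r.eval (h x)) =O[𝓝 0] (fun x : K => x ^ m) := by
    refine (((hp m).comp_tendsto hht).trans (hhO.pow m)).congr' ?_ EventuallyEq.rfl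
    filter_upwards [hsh] with x hx
    simp [hx, hr]
  have hrh : AnalyticAt K (fun x => r.eval (h x)) 0 := by
    simpa [Polynomial.aeval_def] using hh.aeval_polynomial r
  have hg1 : AnalyticAt K (fun x => 1 + g x) 0 := analyticAt_const.add hg
  have hg1ne : ∀ᶠ x in 𝓝 (0 : K), 1 + g x ≠ 0 :=
    hg1.continuousAt.eventually_ne (by simp [hg0])
  have hinv : AnalyticAt K (fun x => (1 + g x)⁻¹) 0 := hg1.inv (by simp [hg0])
  -- This q satisfies (1+g)(1+q) = 1 + r∘h, exactly the factor needed in the fibre.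
  obtain ⟨k, hk, hk0, hkf⟩ := hf.exists_cohomological hrho hm hfm
    (q := fun x => (r.eval (h x) - g x) * (1 + g x)⁻¹) ((hrh.sub hg).mul hinv) (by
      have h1 := hgr.neg_left.mul (hinv.continuousAt.tendsto.isBigO_one K)
      simpa using h1)
  refine ⟨r, mu, h, k, hr0, PowerSeries.degree_trunc_lt p m, hh, hh0, hh1, hk, hk0, ?_, ?_,
    fun p => (s p.1, p.2 / k (s p.1)),
    .skewProduct hs hs0 hhs hsh hk (by simp [hk0]), ?_⟩
  · have hfstA : AnalyticAt K (Prod.fst : K × K → K) 0 := analyticAt_fst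
    have h1 : AnalyticAt K (fun p : K × K => h p.1) 0 := AnalyticAt.comp (g := h) hh hfstA
    have h2 : AnalyticAt K (fun p : K × K => k p.1) 0 := AnalyticAt.comp (g := k) hk hfstA
    exact h1.prod (analyticAt_snd.mul h2)
  · simp [hh0]
  · have hfst : Tendsto (Prod.fst : K × K → K) (𝓝 0) (𝓝 0) := continuous_fst.tendsto 0
    have hkne : ∀ᶠ x in 𝓝 (0 : K), k x ≠ 0 := hk.continuousAt.eventually_ne (by simp [hk0])
    have hsfst := hst.comp hfst
    filter_upwards [hfst.eventually hhs, hsfst.eventually hconj, hsfst.eventually hkf,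
      hsfst.eventually hkne, hsfst.eventually hg1ne] with p h1 h2 h3 h4 h5
    simp only [Function.comp_apply] at h2 h3 h4 h5
    ext
    · simp only [h2, h1]
    · simp only [h3, h1]
      field_simp
      ring
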